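/- A learning algorithm without quantum memory that uses $T$ copies of an unknown $n$-qubit state $\rho$ is a rooted tree in which every root-to-leaf path has length $T$: at each non-leaf node $u$ a fresh copy of $\rho$ is measured by itself with a (finite-outcome) POVM $\{F^u_s\}_s$ that may depend on $u$, i.e. on all previous outcomes, and outcome $s$, which has probability $\operatorname{Tr}(F^u_s\rho)$, leads to the corresponding child of $u$; the output of the algorithm is a function of the leaf that is reached. **Theorem.** For every success probability $p>1/2$ there is a constant $c=c(p)>0$ such that the following holds for all $n$, all $M\ge 1$ and all traceless observables (Hermitian matrices) $O_1,\dots,O_M$ on $n$ qubits with operator norm $\|O_i\|\le 1$. Let $$\delta=\delta(O_1,\dots,O_M)=\frac1M\max_{|\phi\rangle}\sum_{i=1}^M\langle\phi|O_i|\phi\rangle^2 ,$$ the maximum being over all unit vectors. 1. (Distinguishing.) Let $0<\epsilon\le 1$. Suppose that, with probability $1/2$ each, the unknown state is either $\rho_0=I/2^n$ or $\rho_i=(I+\epsilon O_i)/2^n$ for a uniformly random $i\in\{1,\dots,M\}$. Every learning algorithm without quantum memory that decides with success probability at least $p$ which of the two cases holds uses $$T\ \ge\ \frac{c}{\epsilon^2\,\delta}$$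 copies of $\rho$ (in particular, no such algorithm exists if $\delta=0$). 2. (Predicting.) Let $\kappa>0$ be such that $\operatorname{Tr}(O_i^2)\ge\kappa 2^n$ for all $i$. Let $0<\epsilon<\kappa$, and consider a learning algorithm without quantum memory that, for every $n$-qubit state $\rho$, outputs with probability at least $p$ estimates of $\operatorname{Tr}(O_1\rho),\dots,\operatorname{Tr}(O_M\rho)$ that are all within error at most $\epsilon$. Then $\delta>0$ and it uses $$T\ \ge\ \frac{c\,\kappa^2}{\epsilon^2\,\delta}$$ copies of $\rho$. The same holds for $\epsilon=\kappa$ if all errors are required to be strictly less than $\epsilon$. In particular, if $O_i^2=I$ for all $i$ (for instance for Pauli observables), one may take $\kappa=1$: predicting all $\operatorname{Tr}(O_i\rho)$ to within $\pm\epsilon$ requires $T\ge\Omega(1/(\epsilon^2\delta))$ for the full range of $\epsilon$. The observables need not be closed under negation. -/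

import Mathlib

open scoped Matrix ComplexOrder

noncomputable section

namespace ShadowLower

/-- Operators on `n` qubits: complex matrices indexed by the `2 ^ n` computational basis strings. -/
abbrev QMatrix (n : ℕ) : Type := Matrix (Fin n → Fin 2) (Fin n → Fin 2) ℂ

/-- A (mixed) state of `n` qubits: a density matrix. -/
def IsState {n : ℕ} (ρ : QMatrix n) : Prop := ρ.PosSemidef ∧ ρ.trace = 1

/-- A POVM on `n` qubits with the `k` outcomes `0, …, k - 1`. Rank-one POVMs
`{ω_s 2 ^ n |ψ_s⟩⟨ψ_s|}` are a special case. -/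
structure POVM (n k : ℕ) where
  /-- The POVM element of each outcome. -/
  effect : Fin k → QMatrix n
  posSemidef : ∀ s, (effect s).PosSemidef
  sum_effect : ∑ s, effect s = 1

/-- The probability `Tr (F_s ρ)` of the outcome `s` when `ρ` is measured. -/
def POVM.prob {n k : ℕ} (F : POVM n k) (ρ : QMatrix n) (s : Fin k) : ℝ :=
  (F.effect s * ρ).trace.re

/-- A learning algorithm without quantum memory that uses `T` copies of the unknown `n`-qubit state:
a rooted tree all of whose root-to-leaf paths have length `T`. At every non-leaf node one fresh copy
is measured, by itself, with a POVM that depends on the node, that is, on all earlier outcomes; the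
children of the node are indexed by the outcomes. -/
inductive LearningTree (n : ℕ) : ℕ → Type
  | leaf : LearningTree n 0
  | node {T k : ℕ} (F : POVM n k) (child : Fin k → LearningTree n T) : LearningTree n (T + 1)

namespace LearningTree

/-- The leaves of a learning tree: the possible final states of the classical memory. -/
def Leaf {n : ℕ} : {T : ℕ} → LearningTree n T → Type
  | _, leaf => Unit
  | _, node (k := k) _ child => (s : Fin k) × (child s).Leaf

/-- A learning tree has finitely many leaves. -/
@[reducible]
def fintypeLeaf {n : ℕ} : {T : ℕ} → (A : LearningTree n T) → Fintype A.Leaf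
  | _, leaf => inferInstanceAs (Fintype Unit)
  | _, node (k := k) _ child =>
    letI : ∀ s, Fintype (child s).Leaf := fun s => (child s).fintypeLeaf
    inferInstanceAs (Fintype ((s : Fin k) × (child s).Leaf))

instance {n T : ℕ} (A : LearningTree n T) : Fintype A.Leaf := A.fintypeLeaf

/-- The probability that the algorithm, run on copies of `ρ`, ends in the given leaf: the product of
the outcome probabilities along the path from the root. -/
def leafProb {n : ℕ} (ρ : QMatrix n) : {T : ℕ} → (A : LearningTree n T) → A.Leaf → ℝ
  | _, leaf, _ => 1
  | _, node F child, l => F.prob ρ l.1 * (child l.1).leafProb ρ l.2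

open Classical in
/-- The probability that the algorithm, run on copies of `ρ`, ends in a leaf that belongs to `E`. -/
def prob {n T : ℕ} (A : LearningTree n T) (ρ : QMatrix n) (E : Set A.Leaf) : ℝ :=
  ∑ l : A.Leaf, if l ∈ E then A.leafProb ρ l else 0

end LearningTree

/-- An observable of `n` qubits that is traceless and has operator norm at most `1`. -/
def IsTracelessObservable {n : ℕ} (O : QMatrix n) : Prop :=
  O.IsHermitian ∧ O.trace = 0 ∧ ‖Matrix.toEuclideanCLM (𝕜 := ℂ) O‖ ≤ 1

/-- The expectation value `⟨φ|O|φ⟩` of the observable `O`. -/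
def pureExpect {n : ℕ} (O : QMatrix n) (φ : (Fin n → Fin 2) → ℂ) : ℝ :=
  (star φ ⬝ᵥ (O *ᵥ φ)).re

/-- The expectation value `Tr (O ρ)` of the observable `O`. -/
def expect {n : ℕ} (O ρ : QMatrix n) : ℝ := (O * ρ).trace.re

/-- `δ(O_1, …, O_M) = (1 / M) max_φ ∑_i ⟨φ|O_i|φ⟩ ^ 2`, over all unit vectors `φ`. The maximum is
taken of a continuous function over the unit sphere, so the supremum is attained. -/
def delta {n M : ℕ} (O : Fin M → QMatrix n) : ℝ :=
  (1 / (M : ℝ)) * sSup {x : ℝ | ∃ φ : (Fin n → Fin 2) → ℂ,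
    star φ ⬝ᵥ φ = 1 ∧ x = ∑ i, pureExpect (O i) φ ^ 2}

/-- The maximally mixed state `I / 2 ^ n`. -/
def mixedState (n : ℕ) : QMatrix n := ((2 : ℂ) ^ n)⁻¹ • (1 : QMatrix n)

/-- The state `(I + ε O) / 2 ^ n`. -/
def spikeState {n : ℕ} (ε : ℝ) (O : QMatrix n) : QMatrix n :=
  ((2 : ℂ) ^ n)⁻¹ • (1 + (ε : ℂ) • O)

/-- The success probability in the many-versus-one distinguishing task: with probability `1 / 2` the
unknown state is `I / 2 ^ n`, and with probability `1 / 2` it is `(I + ε O_i) / 2 ^ n` for a uniformly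
random `i`. The algorithm announces the second case exactly when it ends in a leaf in `guess`. -/
def distinguishProb {n M T : ℕ} (O : Fin M → QMatrix n) (ε : ℝ) (A : LearningTree n T)
    (guess : Set A.Leaf) : ℝ :=
  (1 / 2) * A.prob (mixedState n) guessᶜ
    + (1 / 2) * ((1 / (M : ℝ)) * ∑ i, A.prob (spikeState ε (O i)) guess)

end ShadowLower

end

open ShadowLower

/-!
Measured on `(I + η O) / 2 ^ n` instead of `I / 2 ^ n`, an effect `F_s` has its probability
multiplied by `1 + η b_s`, where the bias `b_s = Tr (F_s O) / Tr F_s` lies in `[-1, 1]`. Along a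
root-to-leaf path the likelihood ratio is therefore `∏ (1 + η b_t)`, which is at least
`1 - |η ∑ b_t| - 4 η² ∑ b_t²`. Since `O` is traceless, the `b_t` are martingale differences under
`I / 2 ^ n`, so `∑ b_t` has second moment `E ∑ b_t²`, and the two leaf distributions are
`√q + 4 q`-close for `q = η² E ∑ b_t²`. Writing an effect as a sum of `|φ⟩⟨φ|` shows that
`∑_i b_s(O_i)² ≤ M δ` for every effect, so `q` averages to at most `η² T δ` over `i`, and a constant
advantage forces `η² T δ` to be bounded below.

An accurate predictor separates `(I + η O_i) / 2 ^ n` from `(I - η O_i) / 2 ^ n` with `η = ε / κ`,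
although both are close to `I / 2 ^ n`.
-/

namespace ShadowLower

open scoped Matrix.Norms.L2Operator

section RealInequalities

variable {ι : Type*}

lemma exp_sub_two_mul_sq_le_one_add {x : ℝ} (hx : -(1 / 2) ≤ x) :
    Real.exp (x - 2 * x ^ 2) ≤ 1 + x := by
  have hpos : 0 < 1 + x := by linarith
  have hinv : x - 2 * x ^ 2 ≤ 1 - (1 + x)⁻¹ := by
    rw [← sub_nonneg]
    have : 1 - (1 + x)⁻¹ - (x - 2 * x ^ 2) = x ^ 2 * (1 + 2 * x) / (1 + x) := by
      field_simp
      ring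
    rw [this]
    have : 0 ≤ 1 + 2 * x := by linarith
    positivity
  calc Real.exp (x - 2 * x ^ 2) ≤ Real.exp (Real.log (1 + x)) :=
        Real.exp_le_exp.2 (hinv.trans (Real.one_sub_inv_le_log_of_pos hpos))
    _ = 1 + x := Real.exp_log hpos

lemma one_sub_abs_sum_sub_le_prod_one_add (s : Finset ι) {x : ι → ℝ} (hx : ∀ i ∈ s, -1 ≤ x i) :
    1 - |∑ i ∈ s, x i| - 4 * ∑ i ∈ s, x i ^ 2 ≤ ∏ i ∈ s, (1 + x i) := by
  have hsq : 0 ≤ ∑ i ∈ s, x i ^ 2 := Finset.sum_nonneg fun i _ => sq_nonneg (x i)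
  by_cases hhalf : ∀ i ∈ s, -(1 / 2) ≤ x i
  · calc 1 - |∑ i ∈ s, x i| - 4 * ∑ i ∈ s, x i ^ 2
        ≤ (∑ i ∈ s, (x i - 2 * x i ^ 2)) + 1 := by
          rw [Finset.sum_sub_distrib, ← Finset.mul_sum]
          linarith [neg_abs_le (∑ i ∈ s, x i)]
      _ ≤ Real.exp (∑ i ∈ s, (x i - 2 * x i ^ 2)) := Real.add_one_le_exp _
      _ = ∏ i ∈ s, Real.exp (x i - 2 * x i ^ 2) := Real.exp_sum _ _
      _ ≤ ∏ i ∈ s, (1 + x i) := Finset.prod_le_prod (fun _ _ => Real.exp_nonneg _)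
          fun i hi => exp_sub_two_mul_sq_le_one_add (hhalf i hi)
  · push Not at hhalf
    obtain ⟨j, hj, hjx⟩ := hhalf
    have hquarter : 1 / 4 ≤ ∑ i ∈ s, x i ^ 2 :=
      le_trans (by nlinarith) (Finset.single_le_sum (fun i _ => sq_nonneg (x i)) hj)
    have hprod : 0 ≤ ∏ i ∈ s, (1 + x i) := Finset.prod_nonneg fun i hi => by linarith [hx i hi]
    linarith [abs_nonneg (∑ i ∈ s, x i)]

lemma sum_sqrt_le_sqrt_card_mul_sum (s : Finset ι) {q : ι → ℝ} (hq : ∀ i, 0 ≤ q i) :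
    ∑ i ∈ s, √(q i) ≤ √(s.card * ∑ i ∈ s, q i) := by
  simpa using Real.sum_sqrt_mul_sqrt_le s (fun _ => zero_le_one) hq

lemma sq_div_le_of_le_sqrt_add {r q : ℝ} (hr : 0 < r) (hq : 0 ≤ q) (h : r ≤ √q + 4 * q) :
    r ^ 2 / (1 + 8 * r) ≤ q := by
  rw [div_le_iff₀ (by positivity)]
  nlinarith [Real.sq_sqrt hq, sq_nonneg (r - √q)]

lemma pos_and_div_le_of_le_mul {a b t d : ℝ} (ha : 0 < a) (hb : 0 < b) (hd : 0 ≤ d)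
    (h : a ≤ b * (t * d)) : 0 < d ∧ a / (b * d) ≤ t := by
  have hd0 : 0 < d := hd.lt_of_ne (by rintro rfl; linarith)
  refine ⟨hd0, (div_le_iff₀ (by positivity)).2 ?_⟩
  linarith

end RealInequalities

section PureExpect

variable {n : ℕ}

lemma star_dotProduct_self (φ : (Fin n → Fin 2) → ℂ) :
    star φ ⬝ᵥ φ = ((‖WithLp.toLp 2 φ‖ ^ 2 : ℝ) : ℂ) := by
  rw [← dotProduct_comm, ← EuclideanSpace.inner_toLp_toLp, inner_self_eq_norm_sq_to_K]
  simp

lemma pureExpect_one (φ : (Fin n → Fin 2) → ℂ) : pureExpect 1 φ = ‖WithLp.toLp 2 φ‖ ^ 2 := by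
  rw [pureExpect, Matrix.one_mulVec, star_dotProduct_self, Complex.ofReal_re]

lemma pureExpect_smul (O : QMatrix n) (c : ℝ) (φ : (Fin n → Fin 2) → ℂ) :
    pureExpect O ((c : ℂ) • φ) = c ^ 2 * pureExpect O φ := by
  simp only [pureExpect, star_smul, Matrix.mulVec_smul, smul_dotProduct, dotProduct_smul,
    smul_eq_mul, Complex.star_def, Complex.conj_ofReal, Complex.re_ofReal_mul]
  ring

lemma abs_pureExpect_le (O : QMatrix n) (φ : (Fin n → Fin 2) → ℂ) :
    |pureExpect O φ| ≤ ‖O‖ * ‖WithLp.toLp 2 φ‖ ^ 2 := by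
  have hinner : star φ ⬝ᵥ (O *ᵥ φ) = inner ℂ (WithLp.toLp 2 φ) (WithLp.toLp 2 (O *ᵥ φ)) := by
    rw [EuclideanSpace.inner_toLp_toLp, dotProduct_comm]
  calc |pureExpect O φ| ≤ ‖star φ ⬝ᵥ (O *ᵥ φ)‖ := Complex.abs_re_le_norm _
    _ ≤ ‖WithLp.toLp 2 φ‖ * ‖WithLp.toLp 2 (O *ᵥ φ)‖ := hinner ▸ norm_inner_le_norm _ _
    _ ≤ ‖WithLp.toLp 2 φ‖ * (‖O‖ * ‖WithLp.toLp 2 φ‖) := by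
        gcongr
        exact Matrix.l2_opNorm_mulVec O (WithLp.toLp 2 φ)
    _ = ‖O‖ * ‖WithLp.toLp 2 φ‖ ^ 2 := by ring

lemma exists_re_trace_mul_eq_sum_pureExpect {F : QMatrix n} (hF : F.PosSemidef) :
    ∃ (m : ℕ) (φ : Fin m → (Fin n → Fin 2) → ℂ),
      ∀ O : QMatrix n, (F * O).trace.re = ∑ k, pureExpect O (φ k) := by
  obtain ⟨m, φ, rfl⟩ := Matrix.posSemidef_iff_eq_sum_vecMulVec.1 hF
  refine ⟨m, φ, fun O => ?_⟩
  rw [Finset.sum_mul, Matrix.trace_sum, Complex.re_sum]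
  refine Finset.sum_congr rfl fun k _ => ?_
  rw [Matrix.vecMulVec_mul, Matrix.trace_vecMulVec, dotProduct_comm, ← Matrix.dotProduct_mulVec,
    pureExpect]

lemma re_trace_mul_nonneg {F ρ : QMatrix n} (hF : F.PosSemidef) (hρ : ρ.PosSemidef) :
    0 ≤ (F * ρ).trace.re := by
  obtain ⟨m, φ, hφ⟩ := exists_re_trace_mul_eq_sum_pureExpect hF
  exact hφ ρ ▸ Finset.sum_nonneg fun k _ => hρ.re_dotProduct_nonneg (φ k)

lemma abs_re_trace_mul_le {F : QMatrix n} (hF : F.PosSemidef) (O : QMatrix n) :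
    |(F * O).trace.re| ≤ ‖O‖ * F.trace.re := by
  obtain ⟨m, φ, hφ⟩ := exists_re_trace_mul_eq_sum_pureExpect hF
  calc |(F * O).trace.re| ≤ ∑ k, |pureExpect O (φ k)| := hφ O ▸ Finset.abs_sum_le_sum_abs _ _
    _ ≤ ∑ k, ‖O‖ * pureExpect 1 (φ k) :=
        Finset.sum_le_sum fun k _ => pureExpect_one (φ k) ▸ abs_pureExpect_le O (φ k)
    _ = ‖O‖ * F.trace.re := by rw [← Finset.mul_sum, ← hφ, mul_one]

end PureExpect

section Delta

variable {n M : ℕ} (O : Fin M → QMatrix n)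

lemma delta_nonneg : 0 ≤ delta O := by
  refine mul_nonneg (by positivity) (Real.sSup_nonneg ?_)
  rintro _ ⟨φ, -, rfl⟩
  positivity

lemma sum_pureExpect_sq_le_of_unit {φ : (Fin n → Fin 2) → ℂ} (hφ : star φ ⬝ᵥ φ = 1) :
    ∑ i, pureExpect (O i) φ ^ 2 ≤ M * delta O := by
  rcases M.eq_zero_or_pos with rfl | hM
  · simp
  · have hM' : (M : ℝ) ≠ 0 := by positivity
    rw [delta, ← mul_assoc, mul_one_div_cancel hM', one_mul]
    refine le_csSup ⟨∑ i, ‖O i‖ ^ 2, ?_⟩ ⟨φ, hφ, rfl⟩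
    rintro _ ⟨ψ, hψ, rfl⟩
    have hnorm : ‖WithLp.toLp 2 ψ‖ ^ 2 = 1 := by
      exact_mod_cast (star_dotProduct_self ψ).symm.trans hψ
    refine Finset.sum_le_sum fun i _ => sq_le_sq.2 ?_
    simpa [hnorm] using abs_pureExpect_le (O i) ψ

lemma sum_pureExpect_sq_le (φ : (Fin n → Fin 2) → ℂ) :
    ∑ i, pureExpect (O i) φ ^ 2 ≤ M * delta O * pureExpect 1 φ ^ 2 := by
  rw [pureExpect_one]
  set r : ℝ := ‖WithLp.toLp 2 φ‖ with hr
  rcases eq_or_ne r 0 with h0 | h0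
  · have hφ : φ = 0 := by simpa [hr] using h0
    simp [hφ, pureExpect, h0]
  · have hunit : star (((r⁻¹ : ℝ) : ℂ) • φ) ⬝ᵥ (((r⁻¹ : ℝ) : ℂ) • φ) = 1 := by
      rw [star_dotProduct_self, WithLp.toLp_smul, norm_smul, ← hr, Complex.norm_real, norm_inv,
        hr, norm_norm, inv_mul_cancel₀ h0, one_pow, Complex.ofReal_one]
    have hle := sum_pureExpect_sq_le_of_unit O hunit
    simp only [pureExpect_smul, mul_pow, inv_pow, ← Finset.mul_sum] at hle
    rwa [inv_mul_le_iff₀ (by positivity), mul_comm] at hle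

/- The vector `(Tr (F O_i))_i` is a sum of vectors `(⟨φ|O_i|φ⟩)_i`, so its Euclidean norm is
controlled by the triangle inequality. -/
lemma sum_re_trace_mul_sq_le {F : QMatrix n} (hF : F.PosSemidef) :
    ∑ i, (F * O i).trace.re ^ 2 ≤ M * delta O * F.trace.re ^ 2 := by
  obtain ⟨m, φ, hφ⟩ := exists_re_trace_mul_eq_sum_pureExpect hF
  have hδ := delta_nonneg O
  let v (k : Fin m) : EuclideanSpace ℝ (Fin M) := WithLp.toLp 2 fun i => pureExpect (O i) (φ k)
  have hv (k) : ‖v k‖ ≤ √(M * delta O) * pureExpect 1 (φ k) := by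
    have hone : 0 ≤ pureExpect 1 (φ k) := pureExpect_one (φ k) ▸ sq_nonneg _
    refine le_of_sq_le_sq ?_ (by positivity)
    rw [EuclideanSpace.real_norm_sq_eq, mul_pow, Real.sq_sqrt (by positivity)]
    exact sum_pureExpect_sq_le O (φ k)
  calc ∑ i, (F * O i).trace.re ^ 2 = ‖∑ k, v k‖ ^ 2 := by
        simp [EuclideanSpace.real_norm_sq_eq, v, hφ]
    _ ≤ (∑ k, √(M * delta O) * pureExpect 1 (φ k)) ^ 2 := by
        gcongr
        exact norm_sum_le_of_le _ fun k _ => hv k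
    _ = M * delta O * F.trace.re ^ 2 := by
        rw [← Finset.mul_sum, ← hφ, mul_one, mul_pow, Real.sq_sqrt (by positivity)]

end Delta

section States

variable {n : ℕ} {O : QMatrix n} {η : ℝ}

lemma isState_mixedState : IsState (mixedState n) := by
  refine ⟨Matrix.PosSemidef.one.smul (by positivity), ?_⟩
  simp [mixedState]

lemma re_trace_mul_spikeState (F O : QMatrix n) (η : ℝ) :
    (F * spikeState η O).trace.re = (2 ^ n)⁻¹ * (F.trace.re + η * (F * O).trace.re) := by
  have hcast : ((2 : ℂ) ^ n)⁻¹ = (((2 : ℝ) ^ n)⁻¹ : ℝ) := by push_cast; rfl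
  rw [spikeState, Matrix.mul_smul, Matrix.mul_add, Matrix.mul_one, Matrix.mul_smul,
    Matrix.trace_smul, Matrix.trace_add, Matrix.trace_smul, smul_eq_mul, smul_eq_mul, hcast,
    Complex.re_ofReal_mul, Complex.add_re, Complex.re_ofReal_mul]

lemma expect_spikeState (hO : O.trace = 0) (η : ℝ) :
    expect O (spikeState η O) = η * ((O * O).trace.re / 2 ^ n) := by
  rw [expect, re_trace_mul_spikeState, hO, Complex.zero_re]
  ring

lemma trace_spikeState (hO : O.trace = 0) (η : ℝ) : (spikeState η O).trace = 1 := by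
  simp [spikeState, hO]

lemma posSemidef_one_add_smul (hO : O.IsHermitian) (hη : |η| * ‖O‖ ≤ 1) :
    (1 + (η : ℂ) • O).PosSemidef := by
  have hH : (1 + (η : ℂ) • O).IsHermitian :=
    Matrix.isHermitian_one.add (hO.smul (Complex.conj_ofReal η))
  refine Matrix.PosSemidef.of_dotProduct_mulVec_nonneg hH fun φ => ?_
  refine Complex.nonneg_iff.2 ⟨?_, (hH.im_star_dotProduct_mulVec_self φ).symm⟩
  have hre : (star φ ⬝ᵥ ((1 + (η : ℂ) • O) *ᵥ φ)).re =
      ‖WithLp.toLp 2 φ‖ ^ 2 + η * pureExpect O φ := by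
    rw [Matrix.add_mulVec, Matrix.one_mulVec, dotProduct_add, star_dotProduct_self,
      Matrix.smul_mulVec, dotProduct_smul, smul_eq_mul, Complex.add_re, Complex.ofReal_re,
      Complex.re_ofReal_mul, pureExpect]
  have hle : |η * pureExpect O φ| ≤ ‖WithLp.toLp 2 φ‖ ^ 2 :=
    calc |η * pureExpect O φ| ≤ |η| * (‖O‖ * ‖WithLp.toLp 2 φ‖ ^ 2) := by
          rw [abs_mul]
          gcongr
          exact abs_pureExpect_le O φ
      _ ≤ ‖WithLp.toLp 2 φ‖ ^ 2 := by
          rw [← mul_assoc]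
          exact mul_le_of_le_one_left (sq_nonneg _) hη
  rw [hre]
  linarith [neg_abs_le (η * pureExpect O φ)]

lemma isState_spikeState (hH : O.IsHermitian) (htr : O.trace = 0) (hη : |η| * ‖O‖ ≤ 1) :
    IsState (spikeState η O) :=
  ⟨(posSemidef_one_add_smul hH hη).smul (by positivity), trace_spikeState htr η⟩

end States

namespace POVM

variable {n k : ℕ} (F : POVM n k)

lemma prob_nonneg {ρ : QMatrix n} (hρ : ρ.PosSemidef) (s : Fin k) : 0 ≤ F.prob ρ s :=
  re_trace_mul_nonneg (F.posSemidef s) hρ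

lemma sum_re_trace_effect_mul (O : QMatrix n) :
    ∑ s, (F.effect s * O).trace.re = O.trace.re := by
  rw [← Complex.re_sum, ← Matrix.trace_sum, ← Finset.sum_mul, F.sum_effect, Matrix.one_mul]

lemma sum_prob {ρ : QMatrix n} (hρ : ρ.trace = 1) : ∑ s, F.prob ρ s = 1 :=
  (F.sum_re_trace_effect_mul ρ).trans (by rw [hρ, Complex.one_re])

/-- The bias `Tr (F_s O) / Tr F_s` of the outcome `s` towards the observable `O`: the expectation
value of `O` in the state `F_s / Tr F_s`. If `F_s = 0`, then division by zero makes it `0`. -/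
noncomputable def bias (O : QMatrix n) (s : Fin k) : ℝ :=
  (F.effect s * O).trace.re / (F.effect s).trace.re

lemma trace_mul_bias (O : QMatrix n) (s : Fin k) :
    (F.effect s).trace.re * F.bias O s = (F.effect s * O).trace.re := by
  refine mul_div_cancel_of_imp' fun h => ?_
  have hle := abs_re_trace_mul_le (F.posSemidef s) O
  rw [h, mul_zero] at hle
  exact abs_nonpos_iff.1 hle

lemma re_trace_effect_nonneg (s : Fin k) : 0 ≤ (F.effect s).trace.re :=
  (Complex.nonneg_iff.1 (F.posSemidef s).trace_nonneg).1

lemma abs_bias_le (O : QMatrix n) (s : Fin k) : |F.bias O s| ≤ ‖O‖ := by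
  have h := F.re_trace_effect_nonneg s
  rw [bias, abs_div, abs_of_nonneg h]
  exact div_le_of_le_mul₀ h (norm_nonneg O) (abs_re_trace_mul_le (F.posSemidef s) O)

lemma sum_bias_sq_le {M : ℕ} (O : Fin M → QMatrix n) (s : Fin k) :
    ∑ i, F.bias (O i) s ^ 2 ≤ M * delta O := by
  have hδ := delta_nonneg O
  simp only [bias, div_pow]
  rw [← Finset.sum_div]
  exact div_le_of_le_mul₀ (sq_nonneg _) (by positivity) (sum_re_trace_mul_sq_le O (F.posSemidef s))

lemma prob_mixedState (s : Fin k) :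
    F.prob (mixedState n) s = (2 ^ n)⁻¹ * (F.effect s).trace.re := by
  have hspike : mixedState n = spikeState 0 0 := by simp [mixedState, spikeState]
  rw [prob, hspike, re_trace_mul_spikeState, zero_mul, add_zero]

lemma prob_spikeState (O : QMatrix n) (η : ℝ) (s : Fin k) :
    F.prob (spikeState η O) s = F.prob (mixedState n) s * (1 + η * F.bias O s) := by
  rw [prob_mixedState, prob, re_trace_mul_spikeState, ← F.trace_mul_bias]
  ring

lemma sum_prob_mul_bias {O : QMatrix n} (hO : O.trace = 0) :
    ∑ s, F.prob (mixedState n) s * F.bias O s = 0 := by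
  simp only [prob_mixedState, mul_assoc, F.trace_mul_bias]
  rw [← Finset.mul_sum, F.sum_re_trace_effect_mul, hO, Complex.zero_re, mul_zero]

end POVM

namespace LearningTree

variable {n T : ℕ}

section Mean

variable {ρ : QMatrix n}

/-- The mean of a function of the leaf that the algorithm, run on copies of `ρ`, ends in. -/
noncomputable def mean (A : LearningTree n T) (ρ : QMatrix n) (f : A.Leaf → ℝ) : ℝ :=
  ∑ l, A.leafProb ρ l * f l

lemma mean_leaf (f : (leaf : LearningTree n 0).Leaf → ℝ) : leaf.mean ρ f = f () :=
  (Fintype.sum_unique (ι := Unit) _).trans (one_mul _)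

lemma mean_node {k : ℕ} (F : POVM n k) (child : Fin k → LearningTree n T)
    (f : (node F child).Leaf → ℝ) :
    (node F child).mean ρ f = ∑ s, F.prob ρ s * (child s).mean ρ fun l => f ⟨s, l⟩ := by
  have hsigma : (node F child).mean ρ f =
      ∑ s, ∑ l, (node F child).leafProb ρ ⟨s, l⟩ * f ⟨s, l⟩ :=
    Fintype.sum_sigma (ι := Fin k) (α := fun s => (child s).Leaf) _
  rw [hsigma]
  simp only [mean, Finset.mul_sum, leafProb, mul_assoc]

lemma mean_add (A : LearningTree n T) (f g : A.Leaf → ℝ) :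
    A.mean ρ (fun l => f l + g l) = A.mean ρ f + A.mean ρ g := by
  simp only [mean, mul_add, Finset.sum_add_distrib]

lemma mean_const_mul (A : LearningTree n T) (c : ℝ) (f : A.Leaf → ℝ) :
    A.mean ρ (fun l => c * f l) = c * A.mean ρ f := by
  simp only [mean, Finset.mul_sum, mul_left_comm]

lemma mean_sum {ι : Type*} (s : Finset ι) (A : LearningTree n T) (f : ι → A.Leaf → ℝ) :
    A.mean ρ (fun l => ∑ i ∈ s, f i l) = ∑ i ∈ s, A.mean ρ (f i) := by
  simp only [mean, Finset.mul_sum]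
  exact Finset.sum_comm

lemma mean_const (hρ : ρ.trace = 1) (A : LearningTree n T) (c : ℝ) :
    A.mean ρ (fun _ => c) = c := by
  induction A with
  | leaf => exact mean_leaf _
  | node F child ih => simp only [mean_node, ih, ← Finset.sum_mul, F.sum_prob hρ, one_mul]

lemma leafProb_nonneg (hρ : ρ.PosSemidef) (A : LearningTree n T) (l : A.Leaf) :
    0 ≤ A.leafProb ρ l := by
  induction A with
  | leaf => exact zero_le_one
  | node F child ih => exact mul_nonneg (F.prob_nonneg hρ _) (ih _ _)

lemma mean_mono (hρ : ρ.PosSemidef) (A : LearningTree n T) {f g : A.Leaf → ℝ}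
    (h : ∀ l, f l ≤ g l) : A.mean ρ f ≤ A.mean ρ g :=
  Finset.sum_le_sum fun l _ => mul_le_mul_of_nonneg_left (h l) (A.leafProb_nonneg hρ l)

lemma mean_nonneg (hρ : ρ.PosSemidef) (A : LearningTree n T) {f : A.Leaf → ℝ}
    (h : ∀ l, 0 ≤ f l) : 0 ≤ A.mean ρ f :=
  Finset.sum_nonneg fun l _ => mul_nonneg (A.leafProb_nonneg hρ l) (h l)

lemma mean_abs_le_sqrt_mean_sq (hρ : IsState ρ) (A : LearningTree n T) (f : A.Leaf → ℝ) :
    A.mean ρ (fun l => |f l|) ≤ √(A.mean ρ fun l => f l ^ 2) := by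
  have htotal : ∑ l, A.leafProb ρ l = 1 := by simpa [mean] using A.mean_const hρ.2 1
  refine Real.le_sqrt_of_sq_le ?_
  simpa [mean] using Real.pow_arith_mean_le_arith_mean_pow_of_even Finset.univ _ (fun l => |f l|)
    (fun l _ => A.leafProb_nonneg hρ.1 l) htotal even_two

lemma prob_eq_mean (A : LearningTree n T) (E : Set A.Leaf) :
    A.prob ρ E = A.mean ρ (E.indicator 1) := by
  classical
  simp [prob, mean, Set.indicator_apply]

lemma prob_mono (hρ : ρ.PosSemidef) (A : LearningTree n T) {E E' : Set A.Leaf} (h : E ⊆ E') :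
    A.prob ρ E ≤ A.prob ρ E' := by
  rw [prob_eq_mean, prob_eq_mean]
  exact A.mean_mono hρ fun l => Set.indicator_le_indicator_of_subset h (fun _ => zero_le_one) l

lemma prob_compl (hρ : ρ.trace = 1) (A : LearningTree n T) (E : Set A.Leaf) :
    A.prob ρ Eᶜ = 1 - A.prob ρ E := by
  rw [eq_sub_iff_add_eq', prob_eq_mean, prob_eq_mean, ← mean_add]
  simpa only [Set.indicator_self_add_compl_apply, Pi.one_apply] using A.mean_const hρ 1

end Mean

/-- The biases of the outcomes along the path from the root to a leaf, one for each copy. -/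
noncomputable def bias (O : QMatrix n) : {T : ℕ} → (A : LearningTree n T) → A.Leaf → Fin T → ℝ
  | _, leaf, _ => Fin.elim0
  | _, node F child, l => Fin.cons (F.bias O l.1) ((child l.1).bias O l.2)

lemma exists_bias_eq (A : LearningTree n T) (l : A.Leaf) (t : Fin T) :
    ∃ (k : ℕ) (F : POVM n k) (s : Fin k), ∀ O, A.bias O l t = F.bias O s := by
  induction A with
  | leaf => exact t.elim0
  | node F child ih =>
    cases t using Fin.cases with
    | zero => exact ⟨_, F, l.1, fun O => rfl⟩
    | succ t => exact ih l.1 l.2 t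

lemma abs_bias_le (A : LearningTree n T) (O : QMatrix n) (l : A.Leaf) (t : Fin T) :
    |A.bias O l t| ≤ ‖O‖ := by
  obtain ⟨k, F, s, h⟩ := A.exists_bias_eq l t
  exact h O ▸ F.abs_bias_le O s

lemma sum_sum_bias_sq_le {M : ℕ} (A : LearningTree n T) (O : Fin M → QMatrix n) (l : A.Leaf) :
    ∑ i, ∑ t, A.bias (O i) l t ^ 2 ≤ T * (M * delta O) := by
  have hbias (t) : ∑ i, A.bias (O i) l t ^ 2 ≤ M * delta O := by
    obtain ⟨k, F, s, h⟩ := A.exists_bias_eq l t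
    simpa only [h] using F.sum_bias_sq_le O s
  rw [Finset.sum_comm]
  simpa using Finset.sum_le_card_nsmul Finset.univ _ _ fun t _ => hbias t

lemma leafProb_spikeState (A : LearningTree n T) (O : QMatrix n) (η : ℝ) (l : A.Leaf) :
    A.leafProb (spikeState η O) l =
      A.leafProb (mixedState n) l * ∏ t, (1 + η * A.bias O l t) := by
  induction A with
  | leaf => exact (mul_one _).symm
  | node F child ih =>
    simp only [leafProb, bias, ih, F.prob_spikeState, Fin.prod_univ_succ, Fin.cons_zero,
      Fin.cons_succ]
    ring

section Traceless

variable {O : QMatrix n} (hO : O.trace = 0)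
include hO

lemma mean_sum_bias (A : LearningTree n T) :
    A.mean (mixedState n) (fun l => ∑ t, A.bias O l t) = 0 := by
  induction A with
  | leaf => exact mean_leaf _
  | node F child ih =>
    simp only [mean_node, bias, Fin.sum_univ_succ, Fin.cons_zero, Fin.cons_succ, mean_add, ih,
      mean_const isState_mixedState.2, F.sum_prob_mul_bias hO, mul_zero, Finset.sum_const_zero,
      add_zero]

/- The cross terms vanish because the biases are martingale differences. -/
lemma mean_sq_sum_bias (A : LearningTree n T) :
    A.mean (mixedState n) (fun l => (∑ t, A.bias O l t) ^ 2) =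
      A.mean (mixedState n) fun l => ∑ t, A.bias O l t ^ 2 := by
  induction A with
  | leaf => simp [mean_leaf]
  | node F child ih =>
    simp only [mean_node, bias, Fin.sum_univ_succ, Fin.cons_zero, Fin.cons_succ, add_sq, mul_assoc,
      mean_add, mean_const isState_mixedState.2, mean_const_mul, mean_sum_bias hO, ih, mul_zero,
      Finset.sum_const_zero, add_zero]

variable {η : ℝ} (hη : |η| * ‖O‖ ≤ 1)
include hη

lemma prob_mixedState_sub_prob_spikeState_le (A : LearningTree n T) (E : Set A.Leaf) :
    A.prob (mixedState n) E - A.prob (spikeState η O) E ≤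
      √(η ^ 2 * A.mean (mixedState n) fun l => ∑ t, A.bias O l t ^ 2) +
        4 * (η ^ 2 * A.mean (mixedState n) fun l => ∑ t, A.bias O l t ^ 2) := by
  have hstep (l : A.Leaf) (t : Fin T) : -1 ≤ η * A.bias O l t := by
    refine neg_le_of_abs_le ?_
    rw [abs_mul]
    exact (mul_le_mul_of_nonneg_left (A.abs_bias_le O l t) (abs_nonneg η)).trans hη
  have hlikelihood (l : A.Leaf) : 1 - ∏ t, (1 + η * A.bias O l t) ≤
      |η * ∑ t, A.bias O l t| + 4 * η ^ 2 * ∑ t, A.bias O l t ^ 2 := by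
    have h := one_sub_abs_sum_sub_le_prod_one_add Finset.univ fun t _ => hstep l t
    simp only [mul_pow, ← Finset.mul_sum] at h
    linarith
  calc A.prob (mixedState n) E - A.prob (spikeState η O) E
      = A.mean (mixedState n)
          (E.indicator fun l => 1 - ∏ t, (1 + η * A.bias O l t)) := by
        classical
        simp only [prob_eq_mean, mean, ← Finset.sum_sub_distrib, leafProb_spikeState,
          Set.indicator_apply, Pi.one_apply]
        refine Finset.sum_congr rfl fun l _ => ?_
        split_ifs <;> ring
    _ ≤ A.mean (mixedState n) fun l =>
          |η * ∑ t, A.bias O l t| + 4 * η ^ 2 * ∑ t, A.bias O l t ^ 2 :=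
        A.mean_mono isState_mixedState.1 <|
          Set.indicator_le' (fun l _ => hlikelihood l) fun l _ => by positivity
    _ ≤ _ := by
        rw [mean_add, mean_const_mul, mul_assoc]
        gcongr
        refine (A.mean_abs_le_sqrt_mean_sq isState_mixedState _).trans_eq ?_
        simp only [mul_pow, mean_const_mul, mean_sq_sum_bias hO]

lemma abs_prob_mixedState_sub_prob_spikeState_le (A : LearningTree n T) (E : Set A.Leaf) :
    |A.prob (mixedState n) E - A.prob (spikeState η O) E| ≤
      √(η ^ 2 * A.mean (mixedState n) fun l => ∑ t, A.bias O l t ^ 2) +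
        4 * (η ^ 2 * A.mean (mixedState n) fun l => ∑ t, A.bias O l t ^ 2) := by
  refine abs_sub_le_iff.2 ⟨A.prob_mixedState_sub_prob_spikeState_le hO hη E, ?_⟩
  have hcompl := A.prob_mixedState_sub_prob_spikeState_le hO hη Eᶜ
  rw [prob_compl isState_mixedState.2, prob_compl (trace_spikeState hO η)] at hcompl
  linarith

end Traceless

end LearningTree

section LowerBounds

variable {n M T : ℕ} {O : Fin M → QMatrix n} {η p : ℝ}

lemma sum_abs_prob_mixedState_sub_prob_spikeState_le (htr : ∀ i, (O i).trace = 0)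
    (hη : ∀ i, |η| * ‖O i‖ ≤ 1) (A : LearningTree n T) (E : Fin M → Set A.Leaf) :
    ∑ i, |A.prob (mixedState n) (E i) - A.prob (spikeState η (O i)) (E i)| ≤
      M * (√(η ^ 2 * (T * delta O)) + 4 * (η ^ 2 * (T * delta O))) := by
  set q : Fin M → ℝ := fun i =>
    η ^ 2 * A.mean (mixedState n) fun l => ∑ t, A.bias (O i) l t ^ 2
  have hq_nonneg (i) : 0 ≤ q i :=
    mul_nonneg (sq_nonneg η) (A.mean_nonneg isState_mixedState.1 fun l => by positivity)
  have hq_sum : ∑ i, q i ≤ M * (η ^ 2 * (T * delta O)) :=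
    calc ∑ i, q i
        = η ^ 2 * A.mean (mixedState n) fun l => ∑ i, ∑ t, A.bias (O i) l t ^ 2 := by
          rw [A.mean_sum, Finset.mul_sum]
      _ ≤ η ^ 2 * A.mean (mixedState n) fun _ => T * (M * delta O) := by
          gcongr
          exact A.mean_mono isState_mixedState.1 fun l => A.sum_sum_bias_sq_le O l
      _ = M * (η ^ 2 * (T * delta O)) := by
          rw [A.mean_const isState_mixedState.2]
          ring
  calc ∑ i, |A.prob (mixedState n) (E i) - A.prob (spikeState η (O i)) (E i)|
      ≤ ∑ i, (√(q i) + 4 * q i) := Finset.sum_le_sum fun i _ =>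
        A.abs_prob_mixedState_sub_prob_spikeState_le (htr i) (hη i) (E i)
    _ ≤ √(M * ∑ i, q i) + 4 * ∑ i, q i := by
        rw [Finset.sum_add_distrib, ← Finset.mul_sum]
        gcongr
        simpa using sum_sqrt_le_sqrt_card_mul_sum Finset.univ hq_nonneg
    _ ≤ √(M * (M * (η ^ 2 * (T * delta O)))) + 4 * (M * (η ^ 2 * (T * delta O))) := by gcongr
    _ = M * (√(η ^ 2 * (T * delta O)) + 4 * (η ^ 2 * (T * delta O))) := by
        rw [← mul_assoc (M : ℝ), Real.sqrt_mul (mul_self_nonneg _),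
          Real.sqrt_mul_self (Nat.cast_nonneg M)]
        ring

lemma two_mul_sub_one_le_of_le_distinguishProb (hM : 0 < M) (htr : ∀ i, (O i).trace = 0)
    (hη : ∀ i, |η| * ‖O i‖ ≤ 1) (A : LearningTree n T) (guess : Set A.Leaf)
    (h : p ≤ distinguishProb O η A guess) :
    2 * p - 1 ≤ √(η ^ 2 * (T * delta O)) + 4 * (η ^ 2 * (T * delta O)) := by
  set B : ℝ := √(η ^ 2 * (T * delta O)) + 4 * (η ^ 2 * (T * delta O))
  have hM' : (0 : ℝ) < M := by exact_mod_cast hM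
  have hspike : ∑ i, A.prob (spikeState η (O i)) guess ≤
      M * A.prob (mixedState n) guess + M * B :=
    calc ∑ i, A.prob (spikeState η (O i)) guess
        ≤ ∑ i, (A.prob (mixedState n) guess +
            |A.prob (mixedState n) guess - A.prob (spikeState η (O i)) guess|) :=
          Finset.sum_le_sum fun i _ => by
            linarith [neg_abs_le (A.prob (mixedState n) guess - A.prob (spikeState η (O i)) guess)]
      _ ≤ M * A.prob (mixedState n) guess + M * B := by
          rw [Finset.sum_add_distrib]
          simpa using
            sum_abs_prob_mixedState_sub_prob_spikeState_le htr hη A fun _ => guess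
  have havg : 1 / (M : ℝ) * ∑ i, A.prob (spikeState η (O i)) guess ≤
      A.prob (mixedState n) guess + B := by
    rw [one_div_mul_eq_div, div_le_iff₀ hM']
    linarith
  rw [distinguishProb, A.prob_compl isState_mixedState.2] at h
  linarith

lemma sub_half_le_of_separates_neg (hM : 0 < M) (htr : ∀ i, (O i).trace = 0)
    (hη : ∀ i, |η| * ‖O i‖ ≤ 1) (A : LearningTree n T) {E E' : Fin M → Set A.Leaf}
    (hdisj : ∀ i, Disjoint (E i) (E' i)) (hE : ∀ i, p ≤ A.prob (spikeState η (O i)) (E i))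
    (hE' : ∀ i, p ≤ A.prob (spikeState (-η) (O i)) (E' i)) :
    p - 1 / 2 ≤ √(η ^ 2 * (T * delta O)) + 4 * (η ^ 2 * (T * delta O)) := by
  set d : Fin M → ℝ := fun i =>
    |A.prob (mixedState n) (E i) - A.prob (spikeState η (O i)) (E i)| with hd
  set d' : Fin M → ℝ := fun i =>
    |A.prob (mixedState n) (E' i) - A.prob (spikeState (-η) (O i)) (E' i)| with hd'
  have hadv (i) : 2 * p - 1 ≤ d i + d' i := by
    have hle := A.prob_mono isState_mixedState.1 (hdisj i).subset_compl_left
    rw [A.prob_compl isState_mixedState.2] at hle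
    have h := neg_abs_le (A.prob (mixedState n) (E i) - A.prob (spikeState η (O i)) (E i))
    have h' := neg_abs_le (A.prob (mixedState n) (E' i) - A.prob (spikeState (-η) (O i)) (E' i))
    simp only [hd, hd']
    linarith [hE i, hE' i]
  have hsum : M * (2 * p - 1) ≤ ∑ i, d i + ∑ i, d' i := by
    rw [← Finset.sum_add_distrib]
    simpa using Finset.card_nsmul_le_sum Finset.univ _ _ fun i _ => hadv i
  have hbound := sum_abs_prob_mixedState_sub_prob_spikeState_le htr hη A E
  have hbound' := sum_abs_prob_mixedState_sub_prob_spikeState_le htr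
    (fun i => (abs_neg η).symm ▸ hη i) A E'
  rw [neg_sq] at hbound'
  refine le_of_mul_le_mul_left ?_ (show (0 : ℝ) < M by exact_mod_cast hM)
  linarith

lemma sub_half_le_of_predicts (hM : 0 < M) (hO : ∀ i, IsTracelessObservable (O i))
    {κ ε : ℝ} (hκ : ∀ i, κ * 2 ^ n ≤ (O i * O i).trace.re) (hε : 0 < ε) (hεκ : ε ≤ κ)
    (A : LearningTree n T) (out : A.Leaf → Fin M → ℝ)
    (h : ∀ ρ, IsState ρ → p ≤ A.prob ρ {l | ∀ i, |out l i - expect (O i) ρ| < ε}) :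
    p - 1 / 2 ≤ √((ε / κ) ^ 2 * (T * delta O)) + 4 * ((ε / κ) ^ 2 * (T * delta O)) := by
  have hκ0 : 0 < κ := hε.trans_le hεκ
  set η : ℝ := ε / κ
  have hη0 : 0 < η := by positivity
  have hηO (i) : |η| * ‖O i‖ ≤ 1 :=
    mul_le_one₀ ((abs_of_pos hη0).trans_le ((div_le_one hκ0).2 hεκ)) (norm_nonneg _) (hO i).2.2
  have hsep (i) : ε ≤ η * ((O i * O i).trace.re / 2 ^ n) :=
    calc ε = η * κ := (div_mul_cancel₀ ε hκ0.ne').symm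
      _ ≤ η * ((O i * O i).trace.re / 2 ^ n) := by
          gcongr
          exact (le_div_iff₀ (by positivity)).2 (hκ i)
  refine sub_half_le_of_separates_neg hM (fun i => (hO i).2.1) hηO A (fun i => ?_)
    (fun i => h _ (isState_spikeState (hO i).1 (hO i).2.1 (hηO i)))
    (fun i => h _ (isState_spikeState (hO i).1 (hO i).2.1 ((abs_neg η).symm ▸ hηO i)))
  refine Set.disjoint_left.2 fun l hl hl' => ?_
  have hlower := (abs_lt.1 (hl i)).1
  have hupper := (abs_lt.1 (hl' i)).2
  rw [expect_spikeState (hO i).2.1] at hlower hupper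
  linarith [hsep i]

/- An error of at most `ε < κ` is an error of strictly less than `min κ (2 * ε)`. -/
lemma exists_lt_accuracy {κ ε : ℝ} (hε : 0 < ε) (A : LearningTree n T)
    (out : A.Leaf → Fin M → ℝ)
    (h : (ε < κ ∧ ∀ ρ, IsState ρ → p ≤ A.prob ρ {l | ∀ i, |out l i - expect (O i) ρ| ≤ ε}) ∨
      (ε ≤ κ ∧ ∀ ρ, IsState ρ → p ≤ A.prob ρ {l | ∀ i, |out l i - expect (O i) ρ| < ε})) :
    ∃ ε', 0 < ε' ∧ ε' ≤ κ ∧ ε' ≤ 2 * ε ∧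
      ∀ ρ, IsState ρ → p ≤ A.prob ρ {l | ∀ i, |out l i - expect (O i) ρ| < ε'} := by
  rcases h with ⟨hεκ, h⟩ | ⟨hεκ, h⟩
  · have hlt : ε < min κ (2 * ε) := lt_min hεκ (by linarith)
    exact ⟨min κ (2 * ε), hε.trans hlt, min_le_left _ _, min_le_right _ _, fun ρ hρ =>
      (h ρ hρ).trans (A.prob_mono hρ.1 fun l hl i => (hl i).trans_lt hlt)⟩
  · exact ⟨ε, hε, hεκ, by linarith, h⟩

end LowerBounds

end ShadowLower

theorem theoremA2 (p : ℝ) (hp : 1 / 2 < p) :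
    ∃ c : ℝ, 0 < c ∧ ∀ (n M : ℕ), 0 < M → ∀ O : Fin M → QMatrix n,
      (∀ i, IsTracelessObservable (O i)) →
      -- distinguishing `I / 2 ^ n` from a random `(I + ε O_i) / 2 ^ n`
      (∀ ε : ℝ, 0 < ε → ε ≤ 1 → ∀ (T : ℕ) (A : LearningTree n T) (guess : Set A.Leaf),
        p ≤ distinguishProb O ε A guess →
        0 < delta O ∧ c / (ε ^ 2 * delta O) ≤ T) ∧
      -- predicting all `Tr (O_i ρ)`, for observables with `Tr (O_i ^ 2) ≥ κ 2 ^ n`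
      (∀ κ : ℝ, (∀ i, κ * 2 ^ n ≤ (O i * O i).trace.re) →
        ∀ ε : ℝ, 0 < ε → ∀ (T : ℕ) (A : LearningTree n T) (out : A.Leaf → Fin M → ℝ),
        (ε < κ ∧
            (∀ ρ : QMatrix n, IsState ρ →
              p ≤ A.prob ρ {l | ∀ i, |out l i - expect (O i) ρ| ≤ ε})) ∨
          (ε ≤ κ ∧
            (∀ ρ : QMatrix n, IsState ρ →
              p ≤ A.prob ρ {l | ∀ i, |out l i - expect (O i) ρ| < ε})) →
        0 < delta O ∧ c * κ ^ 2 / (ε ^ 2 * delta O) ≤ T) := by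
  have hr : 0 < p - 1 / 2 := by linarith
  set r : ℝ := p - 1 / 2 with hr_def
  set c : ℝ := r ^ 2 / (1 + 8 * r)
  have hc0 : 0 < c := by positivity
  refine ⟨c / 4, by positivity, fun n M hM O hO => ?_⟩
  have hδ := delta_nonneg O
  refine ⟨fun ε hε hε1 T A guess h => ?_, fun κ hκ ε hε T A out h => ?_⟩
  · have hεO (i) := mul_le_one₀ ((abs_of_pos hε).trans_le hε1) (norm_nonneg _) (hO i).2.2
    have hadv := two_mul_sub_one_le_of_le_distinguishProb hM (fun i => (hO i).2.1) hεO A guess h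
    have hcopies := sq_div_le_of_le_sqrt_add hr (by positivity) (le_trans (by linarith) hadv)
    exact pos_and_div_le_of_le_mul (by positivity) (by positivity) hδ (by linarith)
  · obtain ⟨ε', hε', hε'κ, hε'2, h'⟩ := exists_lt_accuracy hε A out h
    have hκ0 : 0 < κ := hε'.trans_le hε'κ
    have hadv := sub_half_le_of_predicts hM hO hκ hε' hε'κ A out h'
    have hcopies := sq_div_le_of_le_sqrt_add hr (by positivity) hadv
    refine pos_and_div_le_of_le_mul (by positivity) (by positivity) hδ ?_
    calc c / 4 * κ ^ 2 ≤ (ε' / κ) ^ 2 * (T * delta O) / 4 * κ ^ 2 := by gcongr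
      _ = ε' ^ 2 / 4 * (T * delta O) := by field_simp
      _ ≤ (2 * ε) ^ 2 / 4 * (T * delta O) := by gcongr
      _ = ε ^ 2 * (T * delta O) := by ring
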